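/- All Banach spaces and Banach algebras are complex; Banach algebras need not have a unit. Write $F'$ for the dual of a Banach space $F$. For a Banach algebra $A$, the dual $A'$ is an $A$-bimodule via $\langle a\cdot\mu,b\rangle=\langle\mu,ba\rangle$ and $\langle\mu\cdot a,b\rangle=\langle\mu,ab\rangle$. A closed sub-bimodule $X\subseteq A'$ is called a predual of $A$, and $(A,X)$ a dual Banach algebra, if the evaluation map $A\to X'$, $a\mapsto(\mu\mapsto\langle\mu,a\rangle)$, is an isomorphism of Banach spaces (not necessarily isometric); the weak$^*$-topology of $(A,X)$ is then the topology $\sigma(A,X)$. A Banach space $E$ has the approximation property if for every compact $K\subseteq E$ and every $\epsilon>0$ there is a bounded finite-rank operator $T$ on $E$ with $\|Tx-x\|<\epsilon$ for all $x\in K$. Let $E'\hat\otimes E$ be the projective tensor product, that is, the completion of $E'\otimes E$ in the norm $\pi(\tau)=\inf\{\sum_{k=1}^n\|\varphi_k\|\,\|x_k\| : \tau=\sum_{k=1}^n\varphi_k\otimes x_k\}$. Let $\mathcal B(E)$ be the Banach algebra of bounded operators on $E$, and let $\kappa:E'\hat\otimes E\to\mathcal B(E)'$ be the bounded linear map with $\langle\kappa(\varphi\otimes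 x),T\rangle=\varphi(Tx)$. Theorem. Let $E$ be a reflexive Banach space with the approximation property. 1. Let $(A,A_*)$ be a dual Banach algebra and $\theta:\mathcal B(E)\to A$ a Banach algebra isomorphism (a multiplicative, bounded linear bijection with bounded inverse). Then $\theta$ is continuous from the topology $\sigma(\mathcal B(E),\kappa(E'\hat\otimes E))$ to the topology $\sigma(A,A_*)$. 2. $E'\hat\otimes E$ is the unique predual of $\mathcal B(E)$: the map $\kappa$ is isometric, its image $\kappa(E'\hat\otimes E)$ is a predual of $\mathcal B(E)$, and every predual $X\subseteq\mathcal B(E)'$ of $\mathcal B(E)$ equals $\kappa(E'\hat\otimes E)$. -/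

import Mathlib

set_option maxSynthPendingDepth 3

open scoped TensorProduct Topology

noncomputable section

namespace DualBanach

universe u v

section ProjectiveTensorProduct

variable (X : Type u) (Y : Type v)
variable [NormedAddCommGroup X] [NormedSpace ℂ X] [NormedAddCommGroup Y] [NormedSpace ℂ Y]

/-- The algebraic tensor product `X ⊗ Y` of two normed spaces, as a type of its own that carries
the projective norm `π`. -/
def AlgTensor : Type (max u v) := X ⊗[ℂ] Y

instance : AddCommGroup (AlgTensor X Y) := inferInstanceAs (AddCommGroup (X ⊗[ℂ] Y))

instance : Module ℂ (AlgTensor X Y) := inferInstanceAs (Module ℂ (X ⊗[ℂ] Y))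

variable {X Y}

/-- The elementary tensor `x ⊗ y`. -/
def algTmul (x : X) (y : Y) : AlgTensor X Y := x ⊗ₜ[ℂ] y

/-- The numbers `∑ ‖x_k‖ ‖y_k‖`, over all finite representations `τ = ∑ x_k ⊗ y_k`. -/
def reprSums (τ : AlgTensor X Y) : Set ℝ :=
  {r | ∃ (n : ℕ) (x : Fin n → X) (y : Fin n → Y),
    τ = ∑ k, algTmul (x k) (y k) ∧ r = ∑ k, ‖x k‖ * ‖y k‖}

/-- The projective norm `π(τ) = inf {∑ ‖x_k‖ ‖y_k‖ : τ = ∑ x_k ⊗ y_k}`. -/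
def projNorm (τ : AlgTensor X Y) : ℝ := sInf (reprSums τ)

lemma reprSums_nonneg {τ : AlgTensor X Y} {r : ℝ} (hr : r ∈ reprSums τ) : 0 ≤ r := by
  obtain ⟨n, x, y, -, rfl⟩ := hr
  positivity

lemma reprSums_bddBelow (τ : AlgTensor X Y) : BddBelow (reprSums τ) :=
  ⟨0, fun _ hr => reprSums_nonneg hr⟩

lemma reprSums_add {σ τ : AlgTensor X Y} {r s : ℝ} (hr : r ∈ reprSums σ) (hs : s ∈ reprSums τ) :
    r + s ∈ reprSums (σ + τ) := by
  obtain ⟨n, x, y, rfl, rfl⟩ := hr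
  obtain ⟨m, x', y', rfl, rfl⟩ := hs
  refine ⟨n + m, Fin.append x x', Fin.append y y', ?_, ?_⟩ <;> simp [Fin.sum_univ_add]

lemma reprSums_smul {τ : AlgTensor X Y} {r : ℝ} (c : ℂ) (hr : r ∈ reprSums τ) :
    ‖c‖ * r ∈ reprSums (c • τ) := by
  obtain ⟨n, x, y, rfl, rfl⟩ := hr
  refine ⟨n, fun k => c • x k, y, ?_, ?_⟩
  · rw [Finset.smul_sum]
    rfl
  · rw [Finset.mul_sum]
    simp [norm_smul, mul_assoc]

lemma reprSums_nonempty (τ : AlgTensor X Y) : (reprSums τ).Nonempty := by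
  refine TensorProduct.induction_on (motive := fun t => (reprSums (X := X) (Y := Y) t).Nonempty)
    τ ?_ ?_ ?_
  · exact ⟨0, 0, Fin.elim0, Fin.elim0, by simp; rfl, by simp⟩
  · intro x y
    exact ⟨‖x‖ * ‖y‖, 1, fun _ => x, fun _ => y, by simp; rfl, by simp⟩
  · rintro σ τ ⟨r, hr⟩ ⟨s, hs⟩
    exact ⟨r + s, reprSums_add hr hs⟩

lemma projNorm_nonneg (τ : AlgTensor X Y) : 0 ≤ projNorm τ :=
  Real.sInf_nonneg fun _ hr => reprSums_nonneg hr

lemma projNorm_le {τ : AlgTensor X Y} {r : ℝ} (hr : r ∈ reprSums τ) : projNorm τ ≤ r :=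
  csInf_le (reprSums_bddBelow τ) hr

lemma projNorm_add_le (σ τ : AlgTensor X Y) : projNorm (σ + τ) ≤ projNorm σ + projNorm τ := by
  refine le_of_forall_pos_lt_add fun ε hε => ?_
  obtain ⟨r, hr, hr'⟩ := Real.lt_sInf_add_pos (reprSums_nonempty σ) (half_pos hε)
  obtain ⟨s, hs, hs'⟩ := Real.lt_sInf_add_pos (reprSums_nonempty τ) (half_pos hε)
  have h := projNorm_le (reprSums_add hr hs)
  change r < projNorm σ + ε / 2 at hr'
  change s < projNorm τ + ε / 2 at hs'
  linarith

lemma projNorm_smul_le (c : ℂ) (τ : AlgTensor X Y) : projNorm (c • τ) ≤ ‖c‖ * projNorm τ := by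
  refine le_of_forall_pos_lt_add fun ε hε => ?_
  have hc : (0 : ℝ) < ‖c‖ + 1 := by positivity
  obtain ⟨r, hr, hr'⟩ := Real.lt_sInf_add_pos (reprSums_nonempty τ) (div_pos hε hc)
  change r < projNorm τ + ε / (‖c‖ + 1) at hr'
  have h := projNorm_le (reprSums_smul c hr)
  have h1 : ‖c‖ * r ≤ ‖c‖ * (projNorm τ + ε / (‖c‖ + 1)) := by gcongr
  have h2 : ‖c‖ * (ε / (‖c‖ + 1)) < ε := by
    rw [mul_div_assoc', div_lt_iff₀ hc]
    nlinarith
  nlinarith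

lemma projNorm_zero : projNorm (0 : AlgTensor X Y) = 0 := by
  have h := projNorm_smul_le (0 : ℂ) (0 : AlgTensor X Y)
  simp only [zero_smul, norm_zero, zero_mul] at h
  exact le_antisymm h (projNorm_nonneg _)

lemma projNorm_neg (τ : AlgTensor X Y) : projNorm (-τ) = projNorm τ := by
  have h (σ : AlgTensor X Y) : projNorm (-σ) ≤ projNorm σ := by
    simpa using projNorm_smul_le (-1 : ℂ) σ
  exact le_antisymm (h τ) (by simpa using h (-τ))

variable (X Y) in
/-- The projective norm as a group seminorm. -/
def projSeminorm : AddGroupSeminorm (AlgTensor X Y) where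
  toFun := projNorm
  map_zero' := projNorm_zero
  add_le' := projNorm_add_le
  neg' := projNorm_neg

instance : SeminormedAddCommGroup (AlgTensor X Y) :=
  (projSeminorm X Y).toSeminormedAddCommGroup

lemma norm_eq_projNorm (τ : AlgTensor X Y) : ‖τ‖ = projNorm τ := rfl

instance : NormedSpace ℂ (AlgTensor X Y) where
  norm_smul_le := projNorm_smul_le

variable (X Y) in
/-- The projective tensor product: the completion of `X ⊗ Y` in the projective norm. -/
abbrev ProjectiveTensor : Type (max u v) := UniformSpace.Completion (AlgTensor X Y)

/-- The elementary tensor `x ⊗ y` in the projective tensor product. -/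
def tmul (x : X) (y : Y) : ProjectiveTensor X Y := (algTmul x y : AlgTensor X Y)

end ProjectiveTensorProduct

section BanachSpaces

variable (E : Type u) [NormedAddCommGroup E] [NormedSpace ℂ E]

/-- The canonical map `E → E''` is onto. -/
def IsReflexiveSpace : Prop :=
  Function.Surjective (NormedSpace.inclusionInDoubleDual ℂ E)

/-- The approximation property: the identity of `E` can be approximated, uniformly on compact sets,
by bounded operators of finite rank. -/
def HasApproximationProperty : Prop :=
  ∀ K : Set E, IsCompact K → ∀ ε : ℝ, 0 < ε →
    ∃ T : E →L[ℂ] E, FiniteDimensional ℂ (LinearMap.range (T : E →ₗ[ℂ] E)) ∧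
      ∀ x ∈ K, ‖T x - x‖ < ε

/-- The functionals on `B(E)` defined by algebraic tensors: `φ ⊗ x` acts by `T ↦ φ (T x)`. -/
def algPairing : AlgTensor (StrongDual ℂ E) E →ₗ[ℂ] StrongDual ℂ (E →L[ℂ] E) :=
  TensorProduct.lift <| LinearMap.mk₂ ℂ
    (fun (φ : StrongDual ℂ E) (x : E) => φ.comp (ContinuousLinearMap.apply ℂ E x))
    (fun _ _ _ => by ext; simp) (fun _ _ _ => by ext; simp)
    (fun _ _ _ => by ext; simp) (fun _ _ _ => by ext; simp)

variable {E}

lemma algPairing_tmul (φ : StrongDual ℂ E) (x : E) (T : E →L[ℂ] E) :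
    algPairing E (algTmul φ x) T = φ (T x) := by
  simp only [algPairing, algTmul]
  erw [TensorProduct.lift.tmul]
  simp

lemma norm_algPairing_le (τ : AlgTensor (StrongDual ℂ E) E) : ‖algPairing E τ‖ ≤ 1 * ‖τ‖ := by
  rw [one_mul, norm_eq_projNorm]
  refine le_csInf (reprSums_nonempty τ) ?_
  rintro r ⟨n, φ, x, rfl, rfl⟩
  rw [map_sum]
  refine (norm_sum_le _ _).trans (Finset.sum_le_sum fun k _ => ?_)
  refine ContinuousLinearMap.opNorm_le_bound _ (by positivity) fun T => ?_
  rw [algPairing_tmul]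
  calc ‖φ k (T (x k))‖ ≤ ‖φ k‖ * (‖T‖ * ‖x k‖) :=
        (φ k).le_opNorm_of_le (T.le_opNorm _)
    _ = ‖φ k‖ * ‖x k‖ * ‖T‖ := by ring

variable (E) in
/-- The canonical map `E' ⊗̂ E → B(E)'`, the continuous extension of `φ ⊗ x ↦ (T ↦ φ (T x))`. -/
def pairing : ProjectiveTensor (StrongDual ℂ E) E →L[ℂ] StrongDual ℂ (E →L[ℂ] E) :=
  ((algPairing E).mkContinuous 1 norm_algPairing_le).extend UniformSpace.Completion.toComplL

lemma pairing_tmul (φ : StrongDual ℂ E) (x : E) (T : E →L[ℂ] E) :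
    pairing E (tmul φ x) T = φ (T x) := by
  have h := ContinuousLinearMap.extend_eq ((algPairing E).mkContinuous 1 norm_algPairing_le)
    (e := (UniformSpace.Completion.toComplL :
      AlgTensor (StrongDual ℂ E) E →L[ℂ] ProjectiveTensor (StrongDual ℂ E) E))
    UniformSpace.Completion.denseRange_coe
    (UniformSpace.Completion.isUniformInducing_coe _) (algTmul φ x)
  exact (congrArg (fun f => f T) h).trans (algPairing_tmul φ x T)

variable (E) in
/-- `E' ⊗̂ E` as a space of functionals on `B(E)`: the image of the canonical map. -/
def canonicalPredual : Submodule ℂ (StrongDual ℂ (E →L[ℂ] E)) :=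
  LinearMap.range (pairing E : ProjectiveTensor (StrongDual ℂ E) E →ₗ[ℂ] _)

end BanachSpaces

section DualBanachAlgebras

variable {A : Type u} [NonUnitalNormedRing A] [NormedSpace ℂ A]
  [IsScalarTower ℂ A A] [SMulCommClass ℂ A A]

/-- The left action of `A` on its dual: `⟨a · μ, b⟩ = ⟨μ, b a⟩`. -/
def leftAct (a : A) (μ : StrongDual ℂ A) : StrongDual ℂ A :=
  μ.comp ((ContinuousLinearMap.mul ℂ A).flip a)

/-- The right action of `A` on its dual: `⟨μ · a, b⟩ = ⟨μ, a b⟩`. -/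
def rightAct (μ : StrongDual ℂ A) (a : A) : StrongDual ℂ A :=
  μ.comp (ContinuousLinearMap.mul ℂ A a)

/-- `X` is a predual of the Banach algebra `A`, that is, `(A, X)` is a dual Banach algebra: `X` is
a closed sub-bimodule of `A'`, and the map `A → X'` given by evaluation is an isomorphism of
Banach spaces (not necessarily isometric). -/
structure IsPredual (X : Submodule ℂ (StrongDual ℂ A)) : Prop where
  isClosed : IsClosed (X : Set (StrongDual ℂ A))
  leftAct_mem : ∀ a : A, ∀ μ ∈ X, leftAct a μ ∈ X
  rightAct_mem : ∀ a : A, ∀ μ ∈ X, rightAct μ a ∈ X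
  exists_equiv : ∃ e : A ≃L[ℂ] StrongDual ℂ X, ∀ (a : A) (μ : X), e a μ = (μ : StrongDual ℂ A) a

/-- The topology `σ(A, X)` on `A`, which is the weak-star topology when `X` is a predual of `A`. -/
abbrev weakStar (X : Submodule ℂ (StrongDual ℂ A)) : TopologicalSpace A :=
  TopologicalSpace.induced (fun (a : A) (μ : X) => (μ : StrongDual ℂ A) a) inferInstance

end DualBanachAlgebras

end DualBanach

end

open DualBanach

/-! Bounded functionals on `E' ⊗̂ E` are bounded maps `E → E''`, which by reflexivity are operators
on `E`. Hence κ is isometric and its image is a predual (`exists_operator_of_functional`).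

Uniqueness rests on rank-one operators: if `R = φ(·)x`, then `R T R = φ(T x) R`. So a functional μ
in a predual with `μ R ≠ 0` yields `T ↦ φ(T x)` through the bimodule action
(`IsPredual.comp_apply_mem`), and closedness puts all of κ(E' ⊗̂ E) inside the predual. Nested
preduals are equal by Hahn–Banach (`IsPredual.eq_of_le`).

For part 1, pulling the predual of `A` back along θ gives a predual of `B(E)`, which must be the
canonical one. -/

namespace DualBanach

/-! ### Preduals of general Banach algebras -/

section Preduals

variable {A : Type*} [NonUnitalNormedRing A] [NormedSpace ℂ A]
  [IsScalarTower ℂ A A] [SMulCommClass ℂ A A]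

/-- A predual separates the points of the algebra. -/
lemma IsPredual.eq_zero_of_forall {X : Submodule ℂ (StrongDual ℂ A)} (hX : IsPredual X) {a : A}
    (h : ∀ μ ∈ X, μ a = 0) : a = 0 := by
  obtain ⟨e, he⟩ := hX.exists_equiv
  refine e.injective ?_
  ext μ
  rw [he, h _ μ.2]
  simp

/-- Every functional on a predual is the evaluation at an element of the algebra. -/
lemma IsPredual.exists_eq_apply {X : Submodule ℂ (StrongDual ℂ A)} (hX : IsPredual X)
    (f : StrongDual ℂ X) : ∃ a : A, ∀ μ : X, f μ = (μ : StrongDual ℂ A) a := by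
  obtain ⟨e, he⟩ := hX.exists_equiv
  exact ⟨e.symm f, fun μ => by rw [← he, e.apply_symm_apply]⟩

/-- A closed sub-bimodule of `A'` is a predual if it separates the points of `A` and all bounded
functionals on it are evaluations. -/
lemma IsPredual.of_bijective [CompleteSpace A] {X : Submodule ℂ (StrongDual ℂ A)}
    (hc : IsClosed (X : Set (StrongDual ℂ A)))
    (hl : ∀ a : A, ∀ μ ∈ X, leftAct a μ ∈ X) (hr : ∀ a : A, ∀ μ ∈ X, rightAct μ a ∈ X)
    (hinj : ∀ a : A, (∀ μ ∈ X, μ a = 0) → a = 0)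
    (hsurj : ∀ f : StrongDual ℂ X, ∃ a : A, ∀ μ : X, f μ = (μ : StrongDual ℂ A) a) :
    IsPredual X := by
  let ev : A →L[ℂ] StrongDual ℂ X :=
    (ContinuousLinearMap.compL ℂ X (StrongDual ℂ A) ℂ).flip X.subtypeL ∘L
      NormedSpace.inclusionInDoubleDual ℂ A
  have hev (a : A) (μ : X) : ev a μ = (μ : StrongDual ℂ A) a := rfl
  have hker : LinearMap.ker (ev : A →ₗ[ℂ] StrongDual ℂ X) = ⊥ := by
    refine LinearMap.ker_eq_bot'.2 fun a ha => hinj a fun μ hμ => ?_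
    have := hev a ⟨μ, hμ⟩
    rw [show ev a = 0 from ha] at this
    exact this.symm
  have hrange : LinearMap.range (ev : A →ₗ[ℂ] StrongDual ℂ X) = ⊤ := by
    refine LinearMap.range_eq_top.2 fun f => ?_
    obtain ⟨a, ha⟩ := hsurj f
    exact ⟨a, ContinuousLinearMap.ext fun μ => (ha μ).symm⟩
  -- The open mapping theorem supplies the bounded inverse.
  exact ⟨hc, hl, hr, ContinuousLinearEquiv.ofBijective ev hker hrange, hev⟩

/-- Comparable preduals coincide. -/
lemma IsPredual.eq_of_le {X Z : Submodule ℂ (StrongDual ℂ A)} (hX : IsPredual X)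
    (hZ : IsPredual Z) (hle : Z ≤ X) : X = Z := by
  refine le_antisymm (fun μ hμ => ?_) hle
  by_contra hμZ
  have hcl : IsClosed ((Z.comap X.subtype : Submodule ℂ X) : Set X) :=
    hZ.isClosed.preimage continuous_subtype_val
  have hnot : (⟨μ, hμ⟩ : X) ∉ Z.comap X.subtype := hμZ
  let W : Submodule ℂ X := Z.comap X.subtype
  have : IsClosed (W : Set X) := hcl
  -- Hahn–Banach on `X / Z` gives a functional killing `Z` but not μ. It is evaluation at some `a`,
  -- and `Z` separates points, so `a = 0`.
  obtain ⟨g, hg⟩ := SeparatingDual.exists_ne_zero (R := ℂ)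
    (mt (Submodule.Quotient.mk_eq_zero W).1 hnot)
  let f : StrongDual ℂ X := g ∘L W.mkQL
  have hf {ν : X} (hν : ν ∈ W) : f ν = 0 := by
    change g (Submodule.Quotient.mk ν) = 0
    rw [(Submodule.Quotient.mk_eq_zero W).2 hν, map_zero]
  have hfμ : f ⟨μ, hμ⟩ ≠ 0 := hg
  obtain ⟨a, ha⟩ := hX.exists_eq_apply f
  have ha0 : a = 0 := hZ.eq_zero_of_forall fun ν hν => by
    rw [← ha ⟨ν, hle hν⟩]
    exact hf (show (⟨ν, hle hν⟩ : X) ∈ Z.comap X.subtype from hν)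
  exact hfμ (by rw [ha, ha0, map_zero])

/-- Preduals can be pulled back along Banach algebra isomorphisms. -/
lemma IsPredual.comap {B : Type*} [NonUnitalNormedRing B] [NormedSpace ℂ B]
    [IsScalarTower ℂ B B] [SMulCommClass ℂ B B] [CompleteSpace B]
    {X : Submodule ℂ (StrongDual ℂ A)} (hX : IsPredual X) (θ : B ≃L[ℂ] A)
    (hθ : ∀ S T : B, θ (S * T) = θ S * θ T) :
    IsPredual (X.comap ((ContinuousLinearMap.compL ℂ A B ℂ).flip
      (θ.symm : A →L[ℂ] B) : StrongDual ℂ B →ₗ[ℂ] StrongDual ℂ A)) := by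
  have hsymm (a b : A) : θ.symm (a * b) = θ.symm a * θ.symm b := by
    rw [θ.symm_apply_eq, hθ, θ.apply_symm_apply, θ.apply_symm_apply]
  have hcancel (μ : StrongDual ℂ A) : (μ ∘L (θ : B →L[ℂ] A)) ∘L (θ.symm : A →L[ℂ] B) = μ := by
    ext a
    simp
  refine .of_bijective ?_ ?_ ?_ ?_ ?_
  · exact hX.isClosed.preimage (ContinuousLinearMap.continuous _)
  · intro b μ hμ
    rw [Submodule.mem_comap]
    convert hX.leftAct_mem (θ b) _ hμ using 1
    ext a
    simp [leftAct, hsymm]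
  · intro b μ hμ
    rw [Submodule.mem_comap]
    convert hX.rightAct_mem (θ b) _ hμ using 1
    ext a
    simp [rightAct, hsymm]
  · intro b hb
    refine θ.injective ?_
    rw [map_zero]
    refine hX.eq_zero_of_forall fun μ hμ => hb (μ ∘L (θ : B →L[ℂ] A)) ?_
    change (μ ∘L (θ : B →L[ℂ] A)) ∘L (θ.symm : A →L[ℂ] B) ∈ X
    rwa [hcancel]
  · intro f
    -- Transporting `f` to `X` by `μ ↦ μ ∘ θ` makes it evaluation at some `a`; on the pullback it is
    -- then evaluation at `θ⁻¹ a`.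
    let pull : X →L[ℂ] X.comap ((ContinuousLinearMap.compL ℂ A B ℂ).flip
        (θ.symm : A →L[ℂ] B) : StrongDual ℂ B →ₗ[ℂ] StrongDual ℂ A) :=
      (((ContinuousLinearMap.compL ℂ B A ℂ).flip (θ : B →L[ℂ] A)) ∘L X.subtypeL).codRestrict _
        fun μ => by
          change ((μ : StrongDual ℂ A) ∘L (θ : B →L[ℂ] A)) ∘L (θ.symm : A →L[ℂ] B) ∈ X
          rw [hcancel]
          exact μ.2
    obtain ⟨a, ha⟩ := hX.exists_eq_apply (f ∘L pull)
    refine ⟨θ.symm a, fun μ => ?_⟩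
    have h := ha ⟨_, μ.2⟩
    have hp : pull ⟨_, μ.2⟩ = μ := by
      ext b
      simp [pull]
    rw [ContinuousLinearMap.comp_apply, hp] at h
    exact h

end Preduals

/-! ### The predual `E' ⊗̂ E` of `B(E)` -/

section CanonicalPredual

variable {E : Type*} [NormedAddCommGroup E] [NormedSpace ℂ E]

lemma norm_tmul_le (φ : StrongDual ℂ E) (x : E) : ‖tmul φ x‖ ≤ ‖φ‖ * ‖x‖ := by
  rw [tmul, UniformSpace.Completion.norm_coe, norm_eq_projNorm]
  exact projNorm_le ⟨1, fun _ => φ, fun _ => x, by simp, by simp⟩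

lemma tmul_add_left (φ ψ : StrongDual ℂ E) (x : E) : tmul (φ + ψ) x = tmul φ x + tmul ψ x := by
  simp only [tmul, ← UniformSpace.Completion.coe_add]
  exact congrArg _ (TensorProduct.add_tmul φ ψ x)

lemma tmul_add_right (φ : StrongDual ℂ E) (x y : E) : tmul φ (x + y) = tmul φ x + tmul φ y := by
  simp only [tmul, ← UniformSpace.Completion.coe_add]
  exact congrArg _ (TensorProduct.tmul_add φ x y)

lemma tmul_smul_left (c : ℂ) (φ : StrongDual ℂ E) (x : E) : tmul (c • φ) x = c • tmul φ x := by
  rw [tmul, tmul, ← UniformSpace.Completion.coe_smul]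
  exact congrArg _ (TensorProduct.smul_tmul' c φ x).symm

lemma tmul_smul_right (c : ℂ) (φ : StrongDual ℂ E) (x : E) : tmul φ (c • x) = c • tmul φ x := by
  rw [tmul, tmul, ← UniformSpace.Completion.coe_smul]
  exact congrArg _ (TensorProduct.tmul_smul c φ x)

/-- A closed subspace of `E' ⊗̂ E` that contains the elementary tensors is everything. -/
lemma mem_of_forall_tmul_mem {V : Submodule ℂ (ProjectiveTensor (StrongDual ℂ E) E)}
    (hV : IsClosed (V : Set (ProjectiveTensor (StrongDual ℂ E) E)))
    (h : ∀ φ x, tmul φ x ∈ V) (τ : ProjectiveTensor (StrongDual ℂ E) E) : τ ∈ V := by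
  refine UniformSpace.Completion.induction_on τ hV fun σ => ?_
  obtain ⟨-, n, φ, x, rfl, -⟩ := reprSums_nonempty σ
  have : ((∑ k, algTmul (φ k) (x k) : AlgTensor (StrongDual ℂ E) E) :
      ProjectiveTensor (StrongDual ℂ E) E) = ∑ k, tmul (φ k) (x k) :=
    map_sum (UniformSpace.Completion.toComplL (𝕜 := ℂ)) _ _
  rw [this]
  exact V.sum_mem fun k _ => h _ _

/-- A closed subspace contains the image of `E' ⊗̂ E` under any bounded linear map that sends
the elementary tensors into it. -/
lemma map_mem_of_forall_tmul {F : Type*} [NormedAddCommGroup F] [NormedSpace ℂ F]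
    {X : Submodule ℂ F} (hX : IsClosed (X : Set F))
    (L : ProjectiveTensor (StrongDual ℂ E) E →L[ℂ] F)
    (h : ∀ φ x, L (tmul φ x) ∈ X) (τ : ProjectiveTensor (StrongDual ℂ E) E) : L τ ∈ X :=
  mem_of_forall_tmul_mem
    (V := X.comap (L : ProjectiveTensor (StrongDual ℂ E) E →ₗ[ℂ] F)) (hX.preimage L.continuous) h τ

/-- On a reflexive space, every functional on `E' ⊗̂ E` is the pairing with an operator, and
its norm bounds that of the operator. -/
lemma exists_operator_of_functional (hrefl : IsReflexiveSpace E)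
    (f : StrongDual ℂ (ProjectiveTensor (StrongDual ℂ E) E)) :
    ∃ T : E →L[ℂ] E, ‖T‖ ≤ ‖f‖ ∧ ∀ τ, f τ = pairing E τ T := by
  have hbound (φ : StrongDual ℂ E) (x : E) : ‖f (tmul φ x)‖ ≤ ‖f‖ * ‖x‖ * ‖φ‖ :=
    (f.le_opNorm_of_le (norm_tmul_le φ x)).trans_eq (by ring)
  let g (x : E) : StrongDual ℂ (StrongDual ℂ E) :=
    LinearMap.mkContinuous
      { toFun := fun φ => f (tmul φ x)
        map_add' := fun φ ψ => by rw [tmul_add_left, map_add]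
        map_smul' := fun c φ => by rw [tmul_smul_left, map_smul, RingHom.id_apply] }
      (‖f‖ * ‖x‖) fun φ => hbound φ x
  -- Reflexivity represents `φ ↦ f (φ ⊗ x)` by a vector `t x`; linearity of `t` follows because `E'`
  -- separates points.
  choose t ht using fun x => hrefl (g x)
  have hφ (φ : StrongDual ℂ E) (x : E) : φ (t x) = f (tmul φ x) :=
    congrArg (fun F => F φ) (ht x)
  have hnorm (x : E) : ‖t x‖ ≤ ‖f‖ * ‖x‖ := by
    refine NormedSpace.norm_le_dual_bound ℂ _ (by positivity) fun φ => ?_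
    rw [hφ]
    exact hbound φ x
  let T : E →L[ℂ] E := LinearMap.mkContinuous
    { toFun := t
      map_add' := fun x y => (SeparatingDual.eq_iff_forall_dual_eq (R := ℂ)).2 fun φ => by
        rw [map_add, hφ, hφ, hφ, tmul_add_right, map_add]
      map_smul' := fun c x => (SeparatingDual.eq_iff_forall_dual_eq (R := ℂ)).2 fun φ => by
        rw [RingHom.id_apply, map_smul, hφ, hφ, tmul_smul_right, map_smul] } ‖f‖ hnorm
  refine ⟨T, LinearMap.mkContinuous_norm_le _ (norm_nonneg _) _, fun τ => ?_⟩
  -- With the target subspace `⊥`, this says that a bounded map vanishing on elementary tensors is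
  -- zero.
  have h := map_mem_of_forall_tmul (X := ⊥) isClosed_singleton
    (f - (ContinuousLinearMap.apply ℂ ℂ T) ∘L pairing E) (fun φ x => ?_) τ
  · exact sub_eq_zero.1 h
  · change f (tmul φ x) - pairing E (tmul φ x) T = 0
    rw [pairing_tmul, ← hφ, sub_eq_zero]
    rfl

lemma pairing_isometry (hrefl : IsReflexiveSpace E) : Isometry (pairing E) := by
  refine AddMonoidHomClass.isometry_of_norm _ fun τ => le_antisymm ?_ ?_
  · have hp : ‖pairing E‖ ≤ 1 := by
      refine ContinuousLinearMap.opNorm_le_bound _ zero_le_one fun σ => ?_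
      refine UniformSpace.Completion.induction_on σ
        (isClosed_le (by fun_prop) (by fun_prop)) fun ρ => ?_
      have h := ContinuousLinearMap.extend_eq ((algPairing E).mkContinuous 1 norm_algPairing_le)
        (e := (UniformSpace.Completion.toComplL :
          AlgTensor (StrongDual ℂ E) E →L[ℂ] ProjectiveTensor (StrongDual ℂ E) E))
        UniformSpace.Completion.denseRange_coe
        (UniformSpace.Completion.isUniformInducing_coe _) ρ
      rw [UniformSpace.Completion.norm_coe]
      exact (congrArg norm h).trans_le (norm_algPairing_le ρ)
    simpa using (pairing E).le_of_opNorm_le hp τ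
  · obtain ⟨f, hf, hfτ⟩ := exists_dual_vector'' ℂ τ
    obtain ⟨T, hT, hfT⟩ := exists_operator_of_functional hrefl f
    have h1 : ‖τ‖ = ‖pairing E τ T‖ := by
      rw [← hfT, hfτ]
      simp
    rw [h1]
    exact (pairing E τ).unit_le_opNorm T (hT.trans hf)

lemma isClosed_canonicalPredual (hrefl : IsReflexiveSpace E) :
    IsClosed (canonicalPredual E : Set (StrongDual ℂ (E →L[ℂ] E))) :=
  (pairing_isometry hrefl).isClosedEmbedding.isClosed_range

lemma pairing_tmul_mem_canonicalPredual (φ : StrongDual ℂ E) (x : E) :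
    φ.comp (ContinuousLinearMap.apply ℂ E x) ∈ canonicalPredual E :=
  ⟨tmul φ x, ContinuousLinearMap.ext fun T => pairing_tmul φ x T⟩

/-- The canonical predual separates operators. -/
lemma eq_zero_of_forall_canonicalPredual {T : E →L[ℂ] E}
    (h : ∀ μ ∈ canonicalPredual E, μ T = 0) : T = 0 := by
  ext x
  refine (SeparatingDual.eq_iff_forall_dual_eq (R := ℂ)).2 fun φ => ?_
  simpa using h _ (pairing_tmul_mem_canonicalPredual φ x)

lemma isPredual_canonicalPredual [CompleteSpace E] (hrefl : IsReflexiveSpace E) :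
    IsPredual (canonicalPredual E) := by
  have hc := isClosed_canonicalPredual hrefl
  refine .of_bijective hc ?_ ?_ (fun T => eq_zero_of_forall_canonicalPredual) ?_
  · rintro S - ⟨τ, rfl⟩
    refine map_mem_of_forall_tmul hc ((ContinuousLinearMap.compL ℂ _ _ ℂ).flip
      ((ContinuousLinearMap.mul ℂ (E →L[ℂ] E)).flip S) ∘L pairing E) (fun φ x => ?_) τ
    convert pairing_tmul_mem_canonicalPredual φ (S x) using 1
    ext T
    exact pairing_tmul φ x (T * S)
  · rintro S - ⟨τ, rfl⟩
    refine map_mem_of_forall_tmul hc ((ContinuousLinearMap.compL ℂ _ _ ℂ).flip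
      (ContinuousLinearMap.mul ℂ (E →L[ℂ] E) S) ∘L pairing E) (fun φ x => ?_) τ
    convert pairing_tmul_mem_canonicalPredual (φ ∘L S) x using 1
    ext T
    exact pairing_tmul φ x (S * T)
  · intro f
    obtain ⟨T, -, hT⟩ := exists_operator_of_functional hrefl
      (f ∘L (pairing E).codRestrict (canonicalPredual E) fun τ => ⟨τ, rfl⟩)
    refine ⟨T, ?_⟩
    rintro ⟨-, τ, rfl⟩
    exact hT τ

/-- Every predual of `B(E)` contains the functionals `T ↦ φ (T x)`: up to a scalar, they arise
from any functional of the predual by multiplying with the operator `y ↦ φ y • x` on both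
sides. -/
lemma IsPredual.comp_apply_mem {X : Submodule ℂ (StrongDual ℂ (E →L[ℂ] E))} (hX : IsPredual X)
    (φ : StrongDual ℂ E) (x : E) : φ.comp (ContinuousLinearMap.apply ℂ E x) ∈ X := by
  let R : E →L[ℂ] E := φ.smulRight x
  by_cases hR : R = 0
  · convert X.zero_mem
    ext T
    by_contra hne
    have hφ : φ (T x) ≠ 0 := hne
    have hx : x ≠ 0 := by
      rintro rfl
      simp at hφ
    have : φ (T x) • x = 0 := congrArg (fun S => S (T x)) hR
    exact (smul_ne_zero hφ hx) this
  · obtain ⟨μ, hμ, hμR⟩ : ∃ μ ∈ X, μ R ≠ 0 := by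
      by_contra! h
      exact hR (hX.eq_zero_of_forall h)
    have key := X.smul_mem (μ R)⁻¹ (hX.leftAct_mem R _ (hX.rightAct_mem R μ hμ))
    convert key using 1
    ext T
    have hRTR : R * (T * R) = φ (T x) • R := by
      ext y
      simp [R, smul_smul, mul_comm]
    have : (leftAct R (rightAct μ R)) T = φ (T x) * μ R := by
      change μ (R * (T * R)) = _
      rw [hRTR, map_smul, smul_eq_mul]
    simp only [smul_apply, this, smul_eq_mul]
    change φ (T x) = _
    field_simp

lemma IsPredual.eq_canonicalPredual [CompleteSpace E] (hrefl : IsReflexiveSpace E)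
    {X : Submodule ℂ (StrongDual ℂ (E →L[ℂ] E))} (hX : IsPredual X) :
    X = canonicalPredual E := by
  refine hX.eq_of_le (isPredual_canonicalPredual hrefl) ?_
  rintro - ⟨τ, rfl⟩
  refine map_mem_of_forall_tmul hX.isClosed (pairing E) (fun φ x => ?_) τ
  convert hX.comp_apply_mem φ x using 1
  ext T
  exact pairing_tmul φ x T

/-- Banach algebra isomorphisms from `B(E)` onto a dual Banach algebra are weak-star
continuous. -/
lemma IsPredual.continuous_weakStar [CompleteSpace E] (hrefl : IsReflexiveSpace E)
    {A : Type*} [NonUnitalNormedRing A] [NormedSpace ℂ A] [IsScalarTower ℂ A A]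
    [SMulCommClass ℂ A A] {X : Submodule ℂ (StrongDual ℂ A)} (hX : IsPredual X)
    (θ : (E →L[ℂ] E) ≃L[ℂ] A) (hθ : ∀ S T : E →L[ℂ] E, θ (S * T) = θ S * θ T) :
    Continuous[weakStar (canonicalPredual E), weakStar X] θ := by
  -- By uniqueness, `μ ∘ θ` lies in the canonical predual, so each coordinate `T ↦ μ (θ T)` is
  -- weak-star continuous.
  have hmem (μ : X) : (μ : StrongDual ℂ A) ∘L (θ : (E →L[ℂ] E) →L[ℂ] A) ∈ canonicalPredual E := by
    rw [← (hX.comap θ hθ).eq_canonicalPredual hrefl]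
    change ((μ : StrongDual ℂ A) ∘L (θ : (E →L[ℂ] E) →L[ℂ] A)) ∘L
      (θ.symm : A →L[ℂ] (E →L[ℂ] E)) ∈ X
    convert μ.2 using 1
    ext a
    simp
  have hc : Continuous[weakStar (canonicalPredual E), inferInstance]
      fun (T : E →L[ℂ] E) (ν : canonicalPredual E) => (ν : StrongDual ℂ (E →L[ℂ] E)) T :=
    continuous_induced_dom
  let _ := weakStar (canonicalPredual E)
  exact continuous_induced_rng.2 (continuous_pi fun μ => continuous_pi_iff.1 hc ⟨_, hmem μ⟩)

end CanonicalPredual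

end DualBanach

open DualBanach
theorem mainTheorem4 {E : Type*} [NormedAddCommGroup E] [NormedSpace ℂ E] [CompleteSpace E]
    (hrefl : IsReflexiveSpace E) (hAP : HasApproximationProperty E) :
    (∀ (A : Type*) [NonUnitalNormedRing A] [NormedSpace ℂ A] [IsScalarTower ℂ A A]
        [SMulCommClass ℂ A A] [CompleteSpace A] (X : Submodule ℂ (StrongDual ℂ A)),
        IsPredual X →
        ∀ θ : (E →L[ℂ] E) ≃L[ℂ] A, (∀ S T : E →L[ℂ] E, θ (S * T) = θ S * θ T) →
          Continuous[weakStar (canonicalPredual E), weakStar X] θ) ∧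
      (Isometry (pairing E) ∧ IsPredual (canonicalPredual E)) ∧
      ∀ X : Submodule ℂ (StrongDual ℂ (E →L[ℂ] E)), IsPredual X → X = canonicalPredual E :=
  ⟨fun _ _ _ _ _ _ _ hX θ hθ => hX.continuous_weakStar hrefl θ hθ,
    ⟨pairing_isometry hrefl, isPredual_canonicalPredual hrefl⟩,
    fun _ hX => hX.eq_canonicalPredual hrefl⟩
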